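/- For a finite simple graph $\Gamma$ with vertex set $V$ and edge set $E$, let $$G(\Gamma)=\langle s\in V \mid s^2=1\ (s\in V),\ (ss')^2=1\ (\{s,s'\}\in E)\rangle$$ be the right-angled Coxeter group based on $\Gamma$. A word $w\in V^*$ is geodesic if its length $|w|$ equals $|\overline w|_V$, the least length of a word over $V$ representing the same element $\overline w$ of $G(\Gamma)$. The geodesic growth series of $G(\Gamma)$ is the formal power series $\sum_{r\ge 0} f(r)\,t^r$, where $f(r)$ is the number of geodesic words of length $r$. For rooted trees $\tau$ and $\sigma$, let $\tau\cdot\sigma$ be the tree obtained from their disjoint union by identifying the two roots. Let $T_1$ and $T_2$ be the trees of McKay on the vertex set $\{0,1,\dots,15\}$, both rooted at $0$, with edges - $T_1$: $01,\ 02,\ 13,\ 14,\ 25,\ 36,\ 47,\ 58,\ 59,\ \{8,10\},\ \{9,11\},\ \{10,12\},\ \{11,13\},\ \{13,14\},\ \{13,15\}$, where $ab$ stands for $\{a,b\}$; - $T_2$: $01,\ 02,\ 13,\ 24,\ 25,\ 36,\ 37,\ 48,\ 59,\ \{8,10\},\ \{9,11\},\ \{11,12\},\ \{11,13\},\ \{12,14\},\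 \{13,15\}$. Then for every finite rooted tree $\tau$, the groups $G(\Gamma_1)$ and $G(\Gamma_2)$ based on $\Gamma_1=\tau\cdot T_1$ and $\Gamma_2=\tau\cdot T_2$ have the same geodesic growth series. -/

import Mathlib

/-- The Coxeter matrix of a simple graph `Γ`: the entry is `1` on the diagonal, `2` at adjacent
vertices and `0` (meaning `∞`, no relation) at distinct non-adjacent vertices. -/
noncomputable def racgMatrix {V : Type*} (Γ : SimpleGraph V) : CoxeterMatrix V where
  M := open Classical in
    Matrix.of fun a b => if a = b then 1 else if Γ.Adj a b then 2 else 0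
  isSymm := by
    ext a b
    have h₁ : (b = a) = (a = b) := propext eq_comm
    have h₂ : Γ.Adj b a = Γ.Adj a b := propext (Γ.adj_comm b a)
    simp only [Matrix.transpose_apply, Matrix.of_apply]
    congr 1
    congr 1
  diagonal a := by simp
  off_diagonal a b h := by
    simp only [Matrix.of_apply, if_neg h]
    split_ifs <;> simp

/-- The right-angled Coxeter group `⟨s ∈ V ∣ s² = 1, (s s')² = 1 for {s, s'} ∈ E(Γ)⟩`. -/
abbrev RACG {V : Type*} (Γ : SimpleGraph V) : Type _ := (racgMatrix Γ).Group

/-- The group `RACG Γ` with its standard generators, the vertices of `Γ`. -/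
noncomputable abbrev racgSystem {V : Type*} (Γ : SimpleGraph V) :
    CoxeterSystem (racgMatrix Γ) (RACG Γ) := (racgMatrix Γ).toCoxeterSystem

/-- The set of geodesic words: words `w` over the vertices of `Γ` whose length equals the word
length, with respect to the vertex generators, of the element of `RACG Γ` that `w` represents. -/
def racgGeodesics {V : Type*} (Γ : SimpleGraph V) : Set (List V) :=
  {w | w.length = (racgSystem Γ).length ((racgSystem Γ).wordProd w)}

/-- The strict growth function of a set of words over an alphabet: the number of its words of
length `r`. -/
noncomputable def strictGrowth {S : Type*} (L : Set (List S)) (r : ℕ) : ℕ :=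
  {w ∈ L | w.length = r}.ncard

/-- The geodesic growth series of the right-angled Coxeter group based on `Γ`. -/
noncomputable def geodesicGrowthSeries {V : Type*} (Γ : SimpleGraph V) : PowerSeries ℕ :=
  PowerSeries.mk (strictGrowth (racgGeodesics Γ))

/-- The coalescence of `τ` rooted at `r` and `σ` rooted at `s`: the two graphs are merged at their
roots. The vertices are those of `τ`, together with those of `σ` other than `s`; the vertex `r`
plays the part of both roots. -/
def coalescence {V W : Type*} (τ : SimpleGraph V) (r : V) (σ : SimpleGraph W) (s : W) :
    SimpleGraph (V ⊕ {w : W // w ≠ s}) where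
  Adj
    | .inl a, .inl b => τ.Adj a b
    | .inl a, .inr w => a = r ∧ σ.Adj s w
    | .inr w, .inl a => a = r ∧ σ.Adj s w
    | .inr w, .inr w' => σ.Adj w w'
  symm := ⟨by
    rintro (a | w) (b | w') h
    · exact SimpleGraph.Adj.symm (G := τ) h
    · exact h
    · exact h
    · exact SimpleGraph.Adj.symm (G := σ) h⟩
  loopless := ⟨by
    rintro (a | w) h
    · exact τ.irrefl h
    · exact σ.irrefl h⟩

/-- McKay's first tree, on the vertices `0, …, 15` and rooted at `0`. -/
def mckayT₁ : SimpleGraph (Fin 16) :=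
  SimpleGraph.fromEdgeSet
    {s(0, 1), s(0, 2), s(1, 3), s(1, 4), s(2, 5), s(3, 6), s(4, 7), s(5, 8), s(5, 9),
      s(8, 10), s(9, 11), s(10, 12), s(11, 13), s(13, 14), s(13, 15)}

/-- McKay's second tree, on the vertices `0, …, 15` and rooted at `0`. -/
def mckayT₂ : SimpleGraph (Fin 16) :=
  SimpleGraph.fromEdgeSet
    {s(0, 1), s(0, 2), s(1, 3), s(2, 4), s(2, 5), s(3, 6), s(3, 7), s(4, 8), s(5, 9),
      s(8, 10), s(9, 11), s(11, 12), s(11, 13), s(12, 14), s(13, 15)}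

/-!
A word is geodesic iff an automaton whose states are the right descent sets of geodesic words
accepts it; words that it accepts are seen to be geodesic through the signs of weights on which the
group acts by the dual of its geometric representation. The growth series `F σ` of the words
accepted from the state `σ` satisfy linear recurrences.

Put `t = X / (1 + X)`. If a triangle-free graph with adjacency matrix `A` and degree matrix `D` is
glued at one vertex to an arbitrary graph, the series of its one- and two-vertex states solve a
linear system with matrix `(1 + t) - t D + t² A`. Hence it influences the series of the states
inside the other graph only through three numbers: the diagonal entry at the root of the inverse
matrix, the row sum there, and the sum of all entries. If these numbers agree for two rooted graphs
and the differences of the series of corresponding states are all divisible by `d`, then they are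
all divisible by `X d`, so they vanish.

McKay's two trees are the same tree rooted at two different vertices, and a single linear system
shows that the three numbers at these vertices agree.
-/

section DescentSets

variable {V : Type*} (Γ : SimpleGraph V)

/-- The right descent set of `g * a`, where `σ` is the right descent set of `g` and `a ∉ σ`: the
letters that can be moved to the end of a geodesic word after `a` has been appended. -/
def descentStep (σ : Set V) (a : V) : Set V := insert a {b ∈ σ | Γ.Adj a b}

theorem descentStep_empty (a : V) : descentStep Γ ∅ a = {a} := by simp [descentStep]

variable {Γ} in
theorem descentStep_insert_of_adj {a b : V} (h : Γ.Adj a b) (σ : Set V) :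
    descentStep Γ (insert b σ) a = insert b (descentStep Γ σ a) := by
  ext c
  simp only [descentStep, Set.mem_insert_iff, Set.mem_ofPred_eq]
  grind

variable {Γ} in
theorem descentStep_insert_of_not_adj {a b : V} (h : ¬Γ.Adj a b) (σ : Set V) :
    descentStep Γ (insert b σ) a = descentStep Γ σ a := by
  ext c
  simp only [descentStep, Set.mem_insert_iff, Set.mem_ofPred_eq]
  grind

/-- The words accepted by the automaton with transitions `descentStep Γ` started at the descent set
`σ`, in which a letter of the current descent set may not be read. -/
def Admissible : Set V → List V → Prop
  | _, [] => True
  | σ, a :: w => a ∉ σ ∧ Admissible (descentStep Γ σ a) w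

/-- The state of the automaton with transitions `descentStep Γ` after reading the word `w`. -/
def descentSet (w : List V) : Set V := w.foldl (descentStep Γ) ∅

theorem descentSet_append_singleton (w : List V) (a : V) :
    descentSet Γ (w ++ [a]) = descentStep Γ (descentSet Γ w) a := by
  simp only [descentSet, List.foldl_append, List.foldl_cons, List.foldl_nil]

theorem admissible_append_singleton (w : List V) (a : V) :
    Admissible Γ ∅ (w ++ [a]) ↔ Admissible Γ ∅ w ∧ a ∉ descentSet Γ w := by
  rw [descentSet]
  generalize (∅ : Set V) = σ
  induction w generalizing σ with
  | nil => simp [Admissible]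
  | cons b w ih => simp [Admissible, ih, and_assoc]

open Classical in
theorem racgMatrix_apply (a b : V) :
    racgMatrix Γ a b = if a = b then 1 else if Γ.Adj a b then 2 else 0 := rfl

local notation "π" => CoxeterSystem.wordProd (racgSystem Γ)
local notation "ℓ" => CoxeterSystem.length (racgSystem Γ)
local notation "gen" => CoxeterSystem.simple (racgSystem Γ)

theorem racg_simple_comm {a b : V} (h : Γ.Adj a b) : gen a * gen b = gen b * gen a := by
  have hab : (gen a * gen b) ^ 2 = 1 := by
    simpa [racgMatrix_apply, h.ne, h] using (racgSystem Γ).simple_mul_simple_pow a b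
  rw [pow_two] at hab
  have hinv := eq_inv_of_mul_eq_one_left hab
  rwa [mul_inv_rev, CoxeterSystem.inv_simple, CoxeterSystem.inv_simple] at hinv

theorem isReduced_append_singleton_iff (w : List V) (a : V) :
    (racgSystem Γ).IsReduced (w ++ [a]) ↔
      (racgSystem Γ).IsReduced w ∧ ¬(racgSystem Γ).IsRightDescent (π w) a := by
  have hlen : ℓ (π w * gen a) = ℓ (π w) + 1 ∨ ℓ (π w * gen a) + 1 = ℓ (π w) :=
    (racgSystem Γ).length_mul_simple _ _
  have hle : ℓ (π w) ≤ w.length := (racgSystem Γ).length_wordProd_le w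
  simp only [CoxeterSystem.IsReduced, CoxeterSystem.wordProd_append,
    CoxeterSystem.wordProd_singleton, List.length_append, List.length_singleton,
    CoxeterSystem.IsRightDescent]
  omega

theorem isRightDescent_of_mem_descentSet {w : List V} (hw : (racgSystem Γ).IsReduced w) {a : V}
    (ha : a ∈ descentSet Γ w) : (racgSystem Γ).IsRightDescent (π w) a := by
  induction w using List.reverseRecOn generalizing a with
  | nil => simp [descentSet] at ha
  | append_singleton w s ih =>
    obtain ⟨hw, hs⟩ := (isReduced_append_singleton_iff Γ w s).1 hw
    have hlen := (racgSystem Γ).length_mul_simple (π w) s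
    rw [descentSet_append_singleton] at ha
    rw [CoxeterSystem.wordProd_append, CoxeterSystem.wordProd_singleton]
    rw [CoxeterSystem.IsRightDescent] at hs ⊢
    rcases ha with rfl | ⟨ha, hadj⟩
    · rw [CoxeterSystem.simple_mul_simple_cancel_right]
      omega
    · have hdesc : ℓ (π w * gen a) < ℓ (π w) := ih hw ha
      have hlen' := (racgSystem Γ).length_mul_simple (π w * gen a) s
      rw [mul_assoc, racg_simple_comm Γ hadj, ← mul_assoc]
      omega

theorem admissible_of_isReduced {w : List V} (hw : (racgSystem Γ).IsReduced w) :
    Admissible Γ ∅ w := by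
  induction w using List.reverseRecOn with
  | nil => trivial
  | append_singleton w s ih =>
    obtain ⟨hw, hs⟩ := (isReduced_append_singleton_iff Γ w s).1 hw
    exact (admissible_append_singleton Γ w s).2
      ⟨ih hw, mt (isRightDescent_of_mem_descentSet Γ hw) hs⟩

open Classical in
/-- The action of the generator `s` on integer weights on the simple roots: the dual of the
geometric representation, with bilinear form `-1` at distinct non-adjacent vertices. -/
noncomputable def reflectWeight (s : V) (φ : V → ℤ) : V → ℤ := fun a =>
  if a = s then -φ s else if Γ.Adj s a then φ a else φ a + 2 * φ s

theorem reflectWeight_self (s : V) (φ : V → ℤ) : reflectWeight Γ s φ s = -φ s := by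
  simp [reflectWeight]

variable {Γ} in
theorem reflectWeight_of_adj {s a : V} (h : Γ.Adj s a) (φ : V → ℤ) :
    reflectWeight Γ s φ a = φ a := by
  simp [reflectWeight, h, h.ne']

variable {Γ} in
theorem reflectWeight_of_not_adj {s a : V} (hne : a ≠ s) (h : ¬Γ.Adj s a) (φ : V → ℤ) :
    reflectWeight Γ s φ a = φ a + 2 * φ s := by
  simp [reflectWeight, h, hne]

theorem reflectWeight_involutive (s : V) : Function.Involutive (reflectWeight Γ s) := by
  intro φ
  funext a
  by_cases hs : a = s
  · subst hs
    simp only [reflectWeight_self, neg_neg]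
  by_cases h : Γ.Adj s a
  · simp only [reflectWeight_of_adj h]
  · simp only [reflectWeight_of_not_adj hs h, reflectWeight_self]
    ring

theorem reflectWeight_comm {s t : V} (h : Γ.Adj s t) (φ : V → ℤ) :
    reflectWeight Γ s (reflectWeight Γ t φ) = reflectWeight Γ t (reflectWeight Γ s φ) := by
  funext a
  have hts := h.symm
  have hne := h.ne
  simp only [reflectWeight]
  split_ifs <;> simp_all
  ring

/-- The generator `s` as a permutation of the integer weights. -/
noncomputable def reflectWeightPerm (s : V) : Equiv.Perm (V → ℤ) :=
  (reflectWeight_involutive Γ s).toPerm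

theorem isLiftable_reflectWeightPerm : (racgMatrix Γ).IsLiftable (reflectWeightPerm Γ) := by
  intro s t
  have hsq (s : V) : reflectWeightPerm Γ s * reflectWeightPerm Γ s = 1 :=
    Equiv.ext (reflectWeight_involutive Γ s)
  rw [racgMatrix_apply]
  split_ifs with hst hadj
  · rw [hst, hsq, one_pow]
  · have hcomm : Commute (reflectWeightPerm Γ s) (reflectWeightPerm Γ t) :=
      Equiv.ext (reflectWeight_comm Γ hadj)
    rw [hcomm.mul_pow, pow_two, pow_two, hsq, hsq, one_mul]
  · rw [pow_zero]

/-- The weight of the element `g`: the image of the constant weight `1` under `g⁻¹`. Its value at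
`a` is positive exactly if `a` is not a right descent of `g`. -/
noncomputable def racgWeight (g : RACG Γ) : V → ℤ :=
  ((racgSystem Γ).lift ⟨_, isLiftable_reflectWeightPerm Γ⟩ g)⁻¹ 1

theorem racgWeight_one : racgWeight Γ 1 = 1 := by simp [racgWeight]

theorem racgWeight_mul_simple (g : RACG Γ) (s : V) :
    racgWeight Γ (g * gen s) = reflectWeight Γ s (racgWeight Γ g) := by
  rw [racgWeight, racgWeight, map_mul, CoxeterSystem.lift_apply_simple, mul_inv_rev]
  rfl

theorem racgWeight_pos_of_admissible {w : List V} (hw : Admissible Γ ∅ w) :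
    (∀ a ∉ descentSet Γ w, 0 < racgWeight Γ (π w) a) ∧
      ∀ a b, a ≠ b → ¬Γ.Adj a b → 0 < racgWeight Γ (π w) a + racgWeight Γ (π w) b := by
  induction w using List.reverseRecOn with
  | nil => simp [racgWeight_one]
  | append_singleton w s ih =>
    obtain ⟨hw, hs⟩ := (admissible_append_singleton Γ w s).1 hw
    obtain ⟨hpos, hsum⟩ := ih hw
    rw [descentSet_append_singleton, CoxeterSystem.wordProd_append,
      CoxeterSystem.wordProd_singleton, racgWeight_mul_simple]
    generalize racgWeight Γ (π w) = φ at *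
    have hφs : 0 < φ s := hpos s hs
    refine ⟨fun a ha => ?_, fun a b hab hnadj => ?_⟩
    · obtain ⟨has, haσ⟩ : a ≠ s ∧ (a ∈ descentSet Γ w → ¬Γ.Adj s a) := by
        simpa [descentStep] using ha
      by_cases hadj : Γ.Adj s a
      · rw [reflectWeight_of_adj hadj]
        exact hpos a fun h => haσ h hadj
      · rw [reflectWeight_of_not_adj has hadj]
        linarith [hsum a s has fun h => hadj h.symm]
    · have hφab := hsum a b hab hnadj
      have hnadj' : ¬Γ.Adj b a := fun h => hnadj h.symm
      unfold reflectWeight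
      split_ifs <;> grind

theorem isReduced_of_admissible {w : List V} (hw : Admissible Γ ∅ w) :
    (racgSystem Γ).IsReduced w := by
  induction w using List.reverseRecOn with
  | nil => simp [CoxeterSystem.IsReduced]
  | append_singleton w s ih =>
    obtain ⟨hw, hs⟩ := (admissible_append_singleton Γ w s).1 hw
    refine (isReduced_append_singleton_iff Γ w s).2 ⟨ih hw, fun hdesc => ?_⟩
    obtain ⟨u, hu, hprod⟩ := (racgSystem Γ).exists_isReduced (π w * gen s)
    have hus : (racgSystem Γ).IsReduced (u ++ [s]) := by
      rw [isReduced_append_singleton_iff, ← hprod]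
      exact ⟨hu, (racgSystem Γ).isRightDescent_iff_not_isRightDescent_mul.1 hdesc⟩
    obtain ⟨hu, hsu⟩ := (admissible_append_singleton Γ u s).1 (admissible_of_isReduced Γ hus)
    have hpos : 0 < racgWeight Γ (π w) s := (racgWeight_pos_of_admissible Γ hw).1 s hs
    have hneg : 0 < -racgWeight Γ (π w) s := by
      simpa only [← hprod, racgWeight_mul_simple, reflectWeight_self] using
        (racgWeight_pos_of_admissible Γ hu).1 s hsu
    linarith

theorem mem_racgGeodesics_iff (w : List V) : w ∈ racgGeodesics Γ ↔ Admissible Γ ∅ w :=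
  ⟨fun h => admissible_of_isReduced Γ (Eq.symm h), fun h => (isReduced_of_admissible Γ h).symm⟩

end DescentSets

section AdmissibleSeries

open PowerSeries

theorem strictGrowth_succ {S : Type*} [Fintype S] (L : Set (List S)) (n : ℕ) :
    strictGrowth L (n + 1) = ∑ a, strictGrowth {w | a :: w ∈ L} n := by
  have hunion : {w ∈ L | w.length = n + 1} =
      ⋃ a, (a :: ·) '' {w ∈ {w | a :: w ∈ L} | w.length = n} := by
    ext w
    cases w <;> simp
  have hfin (a : S) : ((a :: ·) '' {w ∈ {w | a :: w ∈ L} | w.length = n}).Finite :=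
    ((List.finite_length_eq S n).subset fun _ h => h.2).image _
  have hdisj : Pairwise (Function.onFun Disjoint fun a : S =>
      (a :: ·) '' {w ∈ {w | a :: w ∈ L} | w.length = n}) := by
    intro a b hab
    rw [Function.onFun, Set.disjoint_left]
    rintro _ ⟨u, -, rfl⟩ ⟨v, -, huv⟩
    exact hab (List.cons.inj huv).1.symm
  rw [strictGrowth, hunion, Set.ncard_iUnion_of_finite hfin hdisj, finsum_eq_sum_of_fintype]
  exact Finset.sum_congr rfl fun a _ => Set.ncard_image_of_injective _ List.cons_injective

variable {V : Type*} (Γ : SimpleGraph V)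

/-- The growth series of the words admissible from the state `σ`, with integer coefficients so that
series can be subtracted. It counts the words `w` for which `u * w` is geodesic, where `u` is a
fixed geodesic word whose right descent set is `σ`. -/
noncomputable def admissibleSeries (σ : Set V) : ℤ⟦X⟧ :=
  mk fun n => (strictGrowth {w | Admissible Γ σ w} n : ℤ)

theorem map_geodesicGrowthSeries :
    map (Nat.castRingHom ℤ) (geodesicGrowthSeries Γ) = admissibleSeries Γ ∅ := by
  have hset : racgGeodesics Γ = {w | Admissible Γ ∅ w} := Set.ext (mem_racgGeodesics_iff Γ)
  ext n
  simp [geodesicGrowthSeries, admissibleSeries, hset]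

/-- The growth series of the words `w` for which `a :: w` is admissible from the state `σ`. -/
noncomputable def admissibleTailSeries (σ : Set V) (a : V) : ℤ⟦X⟧ :=
  mk fun n => (strictGrowth {w | Admissible Γ σ (a :: w)} n : ℤ)

variable {Γ} in
theorem admissibleTailSeries_of_mem {σ : Set V} {a : V} (ha : a ∈ σ) :
    admissibleTailSeries Γ σ a = 0 := by
  ext n
  simp [admissibleTailSeries, Admissible, strictGrowth, ha]

variable {Γ} in
theorem admissibleTailSeries_of_notMem {σ : Set V} {a : V} (ha : a ∉ σ) :
    admissibleTailSeries Γ σ a = admissibleSeries Γ (descentStep Γ σ a) := by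
  simp [admissibleTailSeries, admissibleSeries, Admissible, ha]

theorem admissibleTailSeries_empty (a : V) :
    admissibleTailSeries Γ ∅ a = admissibleSeries Γ {a} := by
  rw [admissibleTailSeries_of_notMem (Set.notMem_empty a), descentStep_empty]

variable {Γ} in
theorem admissibleTailSeries_insert_of_not_adj {a b : V} (hab : a ≠ b) (h : ¬Γ.Adj a b)
    (σ : Set V) : admissibleTailSeries Γ (insert b σ) a = admissibleTailSeries Γ σ a := by
  simp [admissibleTailSeries, Admissible, descentStep_insert_of_not_adj h, hab]

theorem admissibleTailSeries_singleton_self (a : V) : admissibleTailSeries Γ {a} a = 0 :=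
  admissibleTailSeries_of_mem rfl

variable {Γ} in
theorem admissibleTailSeries_singleton_of_adj {a b : V} (h : Γ.Adj a b) :
    admissibleTailSeries Γ {b} a = admissibleSeries Γ {a, b} := by
  have ha : a ∉ ({b} : Set V) := h.ne
  rw [admissibleTailSeries_of_notMem ha, ← insert_empty_eq, descentStep_insert_of_adj h,
    descentStep_empty, insert_empty_eq, Set.pair_comm]

variable {Γ} in
theorem admissibleTailSeries_singleton_of_not_adj {a b : V} (hab : a ≠ b) (h : ¬Γ.Adj a b) :
    admissibleTailSeries Γ {b} a = admissibleSeries Γ {a} := by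
  rw [← insert_empty_eq, admissibleTailSeries_insert_of_not_adj hab h,
    admissibleTailSeries_empty]

open Classical in
variable {Γ} in
theorem admissibleTailSeries_pair_sub {u v : V} (huv : Γ.Adj u v)
    (hdisj : ∀ a, Γ.Adj a u → ¬Γ.Adj a v) (a : V) :
    admissibleTailSeries Γ {u, v} a - admissibleSeries Γ {a} =
      (admissibleTailSeries Γ {u} a - admissibleSeries Γ {a}) +
        (admissibleTailSeries Γ {v} a - admissibleSeries Γ {a}) -
        (if a = u then admissibleSeries Γ {u, v} - admissibleSeries Γ {u} else 0) -
          if a = v then admissibleSeries Γ {u, v} - admissibleSeries Γ {v} else 0 := by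
  set F := admissibleSeries Γ
  set T := admissibleTailSeries Γ
  by_cases hau : a = u
  · subst hau
    have hmem : T {a, v} a = 0 := admissibleTailSeries_of_mem (Set.mem_insert a _)
    have hself : T {a} a = 0 := admissibleTailSeries_singleton_self Γ a
    have hpair : T {v} a = F {a, v} := admissibleTailSeries_singleton_of_adj huv
    simp [hmem, hself, hpair, huv.ne]
  by_cases hav : a = v
  · subst hav
    have hmem : T {u, a} a = 0 := admissibleTailSeries_of_mem (Set.mem_insert_of_mem u rfl)
    have hself : T {a} a = 0 := admissibleTailSeries_singleton_self Γ a
    have hpair : T {u} a = F {u, a} := by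
      rw [Set.pair_comm]
      exact admissibleTailSeries_singleton_of_adj huv.symm
    simp [hmem, hself, hpair, huv.ne']
  by_cases hua : Γ.Adj a u
  · have hva : ¬Γ.Adj a v := hdisj a hua
    have hunion : T {u, v} a = T {u} a := by
      rw [Set.pair_comm]
      exact admissibleTailSeries_insert_of_not_adj hav hva {u}
    have hv : T {v} a = F {a} := admissibleTailSeries_singleton_of_not_adj hav hva
    simp [hau, hav, hunion, hv]
  · have hunion : T {u, v} a = T {v} a := admissibleTailSeries_insert_of_not_adj hau hua {v}
    have hu : T {u} a = F {a} := admissibleTailSeries_singleton_of_not_adj hau hua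
    simp [hau, hav, hunion, hu]

variable [Fintype V]

theorem admissibleSeries_eq (σ : Set V) :
    admissibleSeries Γ σ = 1 + X * ∑ a, admissibleTailSeries Γ σ a := by
  ext n
  cases n with
  | zero =>
    have hnil : {w ∈ {w | Admissible Γ σ w} | w.length = 0} = {[]} := by
      ext w
      cases w <;> simp [Admissible]
    rw [admissibleSeries, coeff_mk, strictGrowth, hnil]
    simp
  | succ n =>
    rw [map_add, coeff_succ_X_mul, map_sum, admissibleSeries, coeff_mk, strictGrowth_succ]
    simp [admissibleTailSeries, coeff_one]

theorem admissibleSeries_sub_empty (σ : Set V) :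
    admissibleSeries Γ σ - admissibleSeries Γ ∅ =
      X * ∑ a, (admissibleTailSeries Γ σ a - admissibleSeries Γ {a}) := by
  rw [admissibleSeries_eq Γ σ, admissibleSeries_eq Γ ∅, Finset.sum_sub_distrib]
  simp only [admissibleTailSeries_empty]
  ring

open Classical in
theorem admissibleSeries_singleton (v : V) :
    (1 + X) * admissibleSeries Γ {v} = admissibleSeries Γ ∅ +
      X * ∑ a with Γ.Adj v a, (admissibleSeries Γ {a, v} - admissibleSeries Γ {a}) := by
  have hterm (a : V) :
      admissibleTailSeries Γ {v} a - admissibleSeries Γ {a} =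
        (if Γ.Adj v a then admissibleSeries Γ {a, v} - admissibleSeries Γ {a} else 0) -
          if a = v then admissibleSeries Γ {v} else 0 := by
    by_cases hav : a = v
    · simp [hav, admissibleTailSeries_singleton_self]
    by_cases hadj : Γ.Adj a v
    · simp [hav, hadj.symm, admissibleTailSeries_singleton_of_adj hadj]
    · simp [hav, mt SimpleGraph.Adj.symm hadj, admissibleTailSeries_singleton_of_not_adj hav hadj]
  have hsub := admissibleSeries_sub_empty Γ {v}
  rw [Finset.sum_congr rfl fun a _ => hterm a, Finset.sum_sub_distrib, Finset.sum_ite_eq',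
    if_pos (Finset.mem_univ v), ← Finset.sum_filter] at hsub
  linear_combination hsub

omit [Fintype V] in
theorem admissibleSeries_pair [Finite V] {u v : V} (huv : Γ.Adj u v)
    (hdisj : ∀ a, Γ.Adj a u → ¬Γ.Adj a v) :
    (1 + 2 * X) * admissibleSeries Γ {u, v} =
      (1 + X) * (admissibleSeries Γ {u} + admissibleSeries Γ {v}) - admissibleSeries Γ ∅ := by
  classical
  have := Fintype.ofFinite V
  have hsub := admissibleSeries_sub_empty Γ {u, v}
  rw [Finset.sum_congr rfl fun a _ => admissibleTailSeries_pair_sub huv hdisj a,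
    Finset.sum_sub_distrib, Finset.sum_sub_distrib, Finset.sum_add_distrib, Finset.sum_ite_eq',
    Finset.sum_ite_eq', if_pos (Finset.mem_univ u), if_pos (Finset.mem_univ v)] at hsub
  linear_combination hsub - admissibleSeries_sub_empty Γ {u} - admissibleSeries_sub_empty Γ {v}

end AdmissibleSeries

section GeneralizedLaplacian

open Matrix PowerSeries

variable {R : Type*} [CommRing R] (t : R) {W : Type*} [Fintype W] [DecidableEq W]
  (σ : SimpleGraph W)

open Classical in
/-- The matrix `(1 + t) - t D + t² A` of a graph with degree matrix `D` and adjacency matrix `A`.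
Relations between the series of a right-angled Coxeter group along a graph glued at one vertex
become linear equations with this matrix. -/
noncomputable def generalizedLaplacian : Matrix W W R :=
  (1 + t) • 1 - t • σ.degMatrix R + t ^ 2 • σ.adjMatrix R

open Classical in
theorem generalizedLaplacian_mulVec (x : W → R) (v : W) :
    (generalizedLaplacian t σ *ᵥ x) v =
      (1 + t) * x v - t * ∑ a with σ.Adj v a, (x v - t * x a) := by
  simp [generalizedLaplacian, add_mulVec, sub_mulVec, smul_mulVec, SimpleGraph.degMatrix,
    mulVec_diagonal, SimpleGraph.adjMatrix_mulVec_apply, Finset.sum_sub_distrib, ← Finset.mul_sum,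
    ← SimpleGraph.card_neighborFinset_eq_degree, SimpleGraph.neighborFinset_eq_filter]
  ring

theorem isSymm_generalizedLaplacian : (generalizedLaplacian t σ).IsSymm := by
  classical
  simp [generalizedLaplacian, Matrix.IsSymm, SimpleGraph.degMatrix]

variable {t σ} in
theorem generalizedLaplacian_submatrix {W' : Type*} [Fintype W'] [DecidableEq W']
    {σ' : SimpleGraph W'} (φ : σ ≃g σ') :
    (generalizedLaplacian t σ').submatrix φ φ = generalizedLaplacian t σ := by
  classical
  ext v w
  have hdeg : σ'.degree (φ v) = σ.degree v := φ.degree_eq v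
  simp [generalizedLaplacian, SimpleGraph.degMatrix, diagonal_apply, one_apply, hdeg,
    SimpleGraph.adjMatrix_apply, φ.map_adj_iff]

/-- The Green matrix of a graph, the inverse of its generalized Laplacian. -/
noncomputable def greenMatrix : Matrix W W R := (generalizedLaplacian t σ)⁻¹

theorem isSymm_greenMatrix : (greenMatrix t σ).IsSymm := by
  rw [greenMatrix, Matrix.IsSymm, transpose_nonsing_inv, isSymm_generalizedLaplacian]

variable {t σ} in
theorem eq_greenMatrix_mulVec (hdet : IsUnit (generalizedLaplacian t σ).det) {x y : W → R}
    (h : generalizedLaplacian t σ *ᵥ x = y) : x = greenMatrix t σ *ᵥ y := by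
  rw [← h, greenMatrix, mulVec_mulVec, nonsing_inv_mul _ hdet, one_mulVec]

/-- The rooted graphs `(σ₁, s₁)` and `(σ₂, s₂)` have the same Green function at the root, the same
row sum of the Green matrix at the root, and the same sum of all entries of the Green matrix. -/
structure RootEquivalent {W₁ W₂ : Type*} [Fintype W₁] [DecidableEq W₁] [Fintype W₂]
    [DecidableEq W₂] (σ₁ : SimpleGraph W₁) (s₁ : W₁) (σ₂ : SimpleGraph W₂) (s₂ : W₂) : Prop where
  apply_eq : greenMatrix t σ₁ s₁ s₁ = greenMatrix t σ₂ s₂ s₂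
  rowSum_eq : ∑ w, greenMatrix t σ₁ s₁ w = ∑ w, greenMatrix t σ₂ s₂ w
  sum_eq : ∑ v, ∑ w, greenMatrix t σ₁ v w = ∑ v, ∑ w, greenMatrix t σ₂ v w

namespace RootEquivalent

variable {t σ}
variable {W₁ W₂ W₃ : Type*} [Fintype W₁] [DecidableEq W₁] [Fintype W₂] [DecidableEq W₂]
  [Fintype W₃] [DecidableEq W₃] {σ₁ : SimpleGraph W₁} {s₁ : W₁} {σ₂ : SimpleGraph W₂} {s₂ : W₂}
  {σ₃ : SimpleGraph W₃} {s₃ : W₃}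

theorem trans (h₁₂ : RootEquivalent t σ₁ s₁ σ₂ s₂) (h₂₃ : RootEquivalent t σ₂ s₂ σ₃ s₃) :
    RootEquivalent t σ₁ s₁ σ₃ s₃ :=
  ⟨h₁₂.1.trans h₂₃.1, h₁₂.2.trans h₂₃.2, h₁₂.3.trans h₂₃.3⟩

theorem of_iso (φ : σ₁ ≃g σ₂) (s : W₁) : RootEquivalent t σ₁ s σ₂ (φ s) := by
  have hgreen (v w : W₁) : greenMatrix t σ₁ v w = greenMatrix t σ₂ (φ v) (φ w) := by
    rw [greenMatrix, ← generalizedLaplacian_submatrix φ]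
    exact congrFun₂ (inv_submatrix_equiv _ φ.toEquiv φ.toEquiv) v w
  have hrow (v : W₁) : ∑ w, greenMatrix t σ₁ v w = ∑ w, greenMatrix t σ₂ (φ v) w := by
    simp only [hgreen]
    exact φ.toEquiv.sum_comp (greenMatrix t σ₂ (φ v))
  refine ⟨hgreen s s, hrow s, ?_⟩
  simp only [hrow]
  exact φ.toEquiv.sum_comp fun v => ∑ w, greenMatrix t σ₂ v w

/-- Solving with right-hand side `c • (δ_u - δ_v)` compares the two columns of the Green matrix at
`u` and `v`, and symmetry turns this into a comparison of diagonal entries. -/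
theorem of_mulVec_eq [IsDomain R] (hdet : IsUnit (generalizedLaplacian t σ).det) {u v : W} {c : R}
    (hc : c ≠ 0) {x : W → R}
    (hx : generalizedLaplacian t σ *ᵥ x = c • (Pi.single u 1 - Pi.single v 1))
    (huv : x u + x v = 0) (hsum : ∑ w, x w = 0) : RootEquivalent t σ u σ v := by
  have hx (w : W) : x w = c * (greenMatrix t σ w u - greenMatrix t σ w v) := by
    rw [eq_greenMatrix_mulVec hdet hx, mulVec_smul, mulVec_sub]
    simp
  have hsymm := (isSymm_greenMatrix t σ).apply
  refine ⟨mul_left_cancel₀ hc ?_, mul_left_cancel₀ hc ?_, rfl⟩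
  · rw [hx, hx, hsymm u v] at huv
    linear_combination huv
  · simp only [hsymm _ u, hsymm _ v]
    simp only [hx, ← Finset.mul_sum, Finset.sum_sub_distrib] at hsum
    linear_combination hsum

end RootEquivalent

variable {t : ℤ⟦X⟧}

theorem constantCoeff_eq_zero_of_one_add_X_mul_eq (ht : (1 + X) * t = X) :
    constantCoeff t = 0 := by
  simpa using congrArg constantCoeff ht

variable {σ} in
theorem constantCoeff_generalizedLaplacian (ht : constantCoeff t = 0) :
    (generalizedLaplacian t σ).map constantCoeff = 1 := by
  ext v w
  rcases eq_or_ne v w with rfl | hvw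
  · simp [generalizedLaplacian, SimpleGraph.degMatrix, ht]
  · simp [generalizedLaplacian, SimpleGraph.degMatrix, SimpleGraph.adjMatrix_apply, hvw,
      apply_ite constantCoeff, ht]

theorem isUnit_det_generalizedLaplacian (ht : constantCoeff t = 0) :
    IsUnit (generalizedLaplacian t σ).det := by
  rw [isUnit_iff_constantCoeff, RingHom.map_det]
  simp [constantCoeff_generalizedLaplacian ht]

theorem constantCoeff_greenMatrix (ht : constantCoeff t = 0) :
    (greenMatrix t σ).map constantCoeff = 1 := by
  have hmul : generalizedLaplacian t σ * greenMatrix t σ = 1 :=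
    mul_nonsing_inv _ (isUnit_det_generalizedLaplacian σ ht)
  have hmap := congrArg (constantCoeff (R := ℤ)).mapMatrix hmul
  rwa [map_mul, RingHom.mapMatrix_apply, constantCoeff_generalizedLaplacian ht, one_mul,
    map_one] at hmap

theorem constantCoeff_greenMatrix_self (ht : constantCoeff t = 0) (w : W) :
    constantCoeff (greenMatrix t σ w w) = 1 :=
  (congrFun₂ (constantCoeff_greenMatrix σ ht) w w).trans (one_apply_eq w)

theorem constantCoeff_sum_greenMatrix (ht : constantCoeff t = 0) :
    constantCoeff (∑ v, ∑ w, greenMatrix t σ v w) = Fintype.card W := by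
  have happly (v w : W) : constantCoeff (greenMatrix t σ v w) = (1 : Matrix W W ℤ) v w :=
    congrFun₂ (constantCoeff_greenMatrix σ ht) v w
  simp [happly, one_apply]

theorem RootEquivalent.card_eq {W₁ W₂ : Type*} [Fintype W₁] [DecidableEq W₁] [Fintype W₂]
    [DecidableEq W₂] {σ₁ : SimpleGraph W₁} {s₁ : W₁} {σ₂ : SimpleGraph W₂} {s₂ : W₂}
    (ht : constantCoeff t = 0) (h : RootEquivalent t σ₁ s₁ σ₂ s₂) :
    Fintype.card W₁ = Fintype.card W₂ := by
  have hsum := congrArg constantCoeff h.sum_eq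
  rw [constantCoeff_sum_greenMatrix σ₁ ht, constantCoeff_sum_greenMatrix σ₂ ht] at hsum
  exact_mod_cast hsum

end GeneralizedLaplacian

section Coalescence

open Matrix PowerSeries

variable {V W : Type*}

open Classical in
/-- The embedding of the second graph, rooted at `s`, into a coalescence whose common root is the
vertex `r` of the first graph. -/
noncomputable def coalescenceInr (r : V) (s w : W) : V ⊕ {w : W // w ≠ s} :=
  if h : w = s then .inl r else .inr ⟨w, h⟩

theorem coalescenceInr_root (r : V) (s : W) : coalescenceInr r s s = .inl r := dif_pos rfl

theorem coalescenceInr_of_ne (r : V) {s w : W} (h : w ≠ s) :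
    coalescenceInr r s w = .inr ⟨w, h⟩ := dif_neg h

theorem coalescenceInr_injective (r : V) (s : W) : Function.Injective (coalescenceInr r s) := by
  intro w w' h
  by_cases hw : w = s <;> by_cases hw' : w' = s <;> simp_all [coalescenceInr]

variable (τ : SimpleGraph V) (r : V) (σ : SimpleGraph W) (s : W)

theorem coalescence_adj_coalescenceInr {w w' : W} :
    (coalescence τ r σ s).Adj (coalescenceInr r s w) (coalescenceInr r s w') ↔ σ.Adj w w' := by
  by_cases hw : w = s <;> by_cases hw' : w' = s <;>
    simp [coalescenceInr, coalescence, hw, hw', σ.adj_comm]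

variable {τ r σ s} in
theorem exists_of_coalescence_adj_coalescenceInr {w : W} (hw : w ≠ s) {x : V ⊕ {w : W // w ≠ s}}
    (h : (coalescence τ r σ s).Adj x (coalescenceInr r s w)) : ∃ a, coalescenceInr r s a = x := by
  rw [coalescenceInr_of_ne r hw] at h
  rcases x with v | a
  · exact ⟨s, by rw [coalescenceInr_root, h.1]⟩
  · exact ⟨a, coalescenceInr_of_ne r a.2⟩

theorem not_coalescence_adj_of_adj (hσ : σ.CliqueFree 3) {w w' : W} (h : σ.Adj w w')
    (x : V ⊕ {w : W // w ≠ s}) (hw : (coalescence τ r σ s).Adj x (coalescenceInr r s w)) :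
    ¬(coalescence τ r σ s).Adj x (coalescenceInr r s w') := by
  intro hw'
  obtain ⟨a, rfl⟩ : ∃ a, coalescenceInr r s a = x := by
    by_cases hws : w = s
    · exact exists_of_coalescence_adj_coalescenceInr (hws ▸ h.ne') hw'
    · exact exists_of_coalescence_adj_coalescenceInr hws hw
  rw [coalescence_adj_coalescenceInr] at hw hw'
  classical
  exact hσ {a, w, w'} (SimpleGraph.is3Clique_triple_iff.2 ⟨hw, hw', h⟩)

local notation "𝓕" => admissibleSeries (coalescence τ r σ s)
local notation "ι" => coalescenceInr r s

theorem descentStep_image_inl (C : Set V) (v : V) :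
    descentStep (coalescence τ r σ s) (.inl '' C) (.inl v) = .inl '' descentStep τ C v := by
  ext x
  rcases x with v' | w <;> simp [descentStep, coalescence]

theorem admissibleTailSeries_image_inl_inl (C : Set V) (v : V) [Decidable (v ∈ C)] :
    admissibleTailSeries (coalescence τ r σ s) (.inl '' C) (.inl v) =
      if v ∈ C then 0 else 𝓕 (.inl '' descentStep τ C v) := by
  split_ifs with hv
  · exact admissibleTailSeries_of_mem (Set.mem_image_of_mem _ hv)
  · rw [admissibleTailSeries_of_notMem (by simpa using hv), descentStep_image_inl]

theorem admissibleTailSeries_image_inl_inr (C : Set V) (w : {w : W // w ≠ s})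
    [Decidable (r ∈ C)] :
    admissibleTailSeries (coalescence τ r σ s) (.inl '' C) (.inr w) =
      if r ∈ C then admissibleTailSeries (coalescence τ r σ s) {.inl r} (.inr w)
      else 𝓕 {.inr w} := by
  rw [admissibleTailSeries_of_notMem (by simp)]
  have hstep : descentStep (coalescence τ r σ s) (.inl '' C) (.inr w) =
      if r ∈ C then descentStep (coalescence τ r σ s) {.inl r} (.inr w) else {.inr w} := by
    ext x
    split_ifs <;> rcases x with v | w' <;> simp [descentStep, coalescence] <;> grind
  rw [hstep]
  split_ifs
  · rw [admissibleTailSeries_of_notMem (by simp)]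
  · rfl

/-- The growth series of the geodesic words that can be rearranged to begin with the vertex `w` of
the second graph. -/
noncomputable def leadingSeries (w : W) : ℤ⟦X⟧ := 𝓕 ∅ - 𝓕 {ι w}

variable {t : ℤ⟦X⟧} (ht : (1 + X) * t = X)

variable {σ} in
include ht in
theorem one_add_mul_admissibleSeries_pair_sub [Finite V] [Finite W] (hσ : σ.CliqueFree 3) {w a : W}
    (h : σ.Adj w a) :
    (1 + t) * (𝓕 {ι a, ι w} - 𝓕 {ι a}) =
      t * leadingSeries τ r σ s a - leadingSeries τ r σ s w := by
  have hpair := admissibleSeries_pair (coalescence τ r σ s)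
    ((coalescence_adj_coalescenceInr τ r σ s).2 h.symm)
    (not_coalescence_adj_of_adj τ r σ s hσ h.symm)
  rw [leadingSeries, leadingSeries]
  linear_combination (1 - t) * hpair + (2 * 𝓕 {ι a, ι w} - 𝓕 {ι a} - 𝓕 {ι w}) * ht

variable [Fintype W]

open Classical in
/-- The change of the growth series of the state `{a}` when the vertex `w` is adjoined to it, summed
over the neighbours `a` of `w` in the second graph. -/
noncomputable def linkDefect (w : W) : ℤ⟦X⟧ := ∑ a with σ.Adj w a, (𝓕 {ι a, ι w} - 𝓕 {ι a})

open Classical in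
variable {s} in
theorem sum_coalescence_adj_coalescenceInr [Fintype V] [DecidableEq W] {M : Type*}
    [AddCommMonoid M] {w : W} (hw : w ≠ s) (f : V ⊕ {w : W // w ≠ s} → M) :
    ∑ x with (coalescence τ r σ s).Adj (coalescenceInr r s w) x, f x =
      ∑ a with σ.Adj w a, f (coalescenceInr r s a) := by
  rw [← Finset.sum_image fun a _ b _ h => coalescenceInr_injective r s h]
  congr 1
  ext x
  simp only [Finset.mem_filter, Finset.mem_univ, true_and, Finset.mem_image]
  constructor
  · intro h
    obtain ⟨a, rfl⟩ := exists_of_coalescence_adj_coalescenceInr hw h.symm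
    exact ⟨a, (coalescence_adj_coalescenceInr τ r σ s).1 h, rfl⟩
  · rintro ⟨a, h, rfl⟩
    exact (coalescence_adj_coalescenceInr τ r σ s).2 h

include ht in
theorem leadingSeries_add_linkDefect [Finite V] {w : W} (hw : w ≠ s) :
    leadingSeries τ r σ s w + t * linkDefect τ r σ s w = t * 𝓕 ∅ := by
  classical
  have := Fintype.ofFinite V
  have hsingle : (1 + X) * 𝓕 {ι w} = 𝓕 ∅ + X * linkDefect τ r σ s w := by
    rw [admissibleSeries_singleton, sum_coalescence_adj_coalescenceInr τ r σ hw, linkDefect]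
  rw [leadingSeries]
  linear_combination (t - 1) * hsingle + (linkDefect τ r σ s w - 𝓕 {ι w}) * ht

variable [DecidableEq W]

theorem sum_admissibleSeries_inr :
    ∑ w : {w : W // w ≠ s}, 𝓕 {.inr w} =
      Fintype.card W * 𝓕 ∅ - ∑ w, leadingSeries τ r σ s w - 𝓕 {.inl r} := by
  have hsum : ∑ w, 𝓕 {ι w} = 𝓕 {.inl r} + ∑ w : {w : W // w ≠ s}, 𝓕 {.inr w} := by
    rw [Fintype.sum_eq_add_sum_subtype_ne _ s, coalescenceInr_root]
    exact congrArg _ (Finset.sum_congr rfl fun w _ => by rw [coalescenceInr_of_ne r w.2])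
  simp only [leadingSeries, Finset.sum_sub_distrib, Finset.sum_const, Finset.card_univ,
    nsmul_eq_mul]
  linear_combination -hsum

theorem linkDefect_root_eq :
    linkDefect τ r σ s s = ∑ w : {w : W // w ≠ s},
      (admissibleTailSeries (coalescence τ r σ s) {.inl r} (.inr w) - 𝓕 {.inr w}) := by
  classical
  rw [linkDefect, Finset.sum_filter, Fintype.sum_eq_add_sum_subtype_ne _ s, if_neg σ.irrefl,
    zero_add]
  refine Finset.sum_congr rfl fun w _ => ?_
  rw [coalescenceInr_of_ne r w.2, coalescenceInr_root]
  split_ifs with h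
  · rw [admissibleTailSeries_singleton_of_adj]
    exact ⟨rfl, h⟩
  · have hadj : ¬(coalescence τ r σ s).Adj (.inr w) (.inl r) := fun hw => h hw.2
    rw [admissibleTailSeries_singleton_of_not_adj Sum.inr_ne_inl hadj, sub_self]

open Classical in
theorem admissibleSeries_image_inl [Fintype V] (C : Set V) :
    𝓕 (.inl '' C) = 1 + X * ((∑ v, if v ∈ C then 0 else 𝓕 (.inl '' descentStep τ C v)) +
      (∑ w : {w : W // w ≠ s}, 𝓕 {.inr w} + if r ∈ C then linkDefect τ r σ s s else 0)) := by
  rw [admissibleSeries_eq, Fintype.sum_sum_type]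
  simp only [admissibleTailSeries_image_inl_inl, admissibleTailSeries_image_inl_inr]
  congr 3
  split_ifs
  · rw [linkDefect_root_eq, Finset.sum_sub_distrib, add_sub_cancel]
  · rw [add_zero]

variable [Finite V]

variable {σ} in
include ht in
theorem generalizedLaplacian_mulVec_leadingSeries (hσ : σ.CliqueFree 3) (w : W) :
    (generalizedLaplacian t σ *ᵥ leadingSeries τ r σ s) w =
      (1 + t) * (leadingSeries τ r σ s w + t * linkDefect τ r σ s w) := by
  classical
  have hlink : (1 + t) * linkDefect τ r σ s w =
      -∑ a with σ.Adj w a, (leadingSeries τ r σ s w - t * leadingSeries τ r σ s a) := by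
    rw [linkDefect, Finset.mul_sum, ← Finset.sum_neg_distrib]
    refine Finset.sum_congr rfl fun a ha => ?_
    rw [one_add_mul_admissibleSeries_pair_sub τ r s ht hσ (Finset.mem_filter.1 ha).2, neg_sub]
  rw [generalizedLaplacian_mulVec]
  linear_combination -t * hlink

variable {σ} in
include ht in
theorem leadingSeries_eq (hσ : σ.CliqueFree 3) (w : W) :
    leadingSeries τ r σ s w = t * (1 + t) * 𝓕 ∅ * ∑ v, greenMatrix t σ w v +
      (1 + t) * (leadingSeries τ r σ s s + t * linkDefect τ r σ s s - t * 𝓕 ∅) *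
        greenMatrix t σ w s := by
  have ht₀ : constantCoeff t = 0 := constantCoeff_eq_zero_of_one_add_X_mul_eq ht
  have hmul : generalizedLaplacian t σ *ᵥ leadingSeries τ r σ s = (t * (1 + t) * 𝓕 ∅) • 1 +
      ((1 + t) * (leadingSeries τ r σ s s + t * linkDefect τ r σ s s - t * 𝓕 ∅)) •
        Pi.single s 1 := by
    ext1 v
    rw [generalizedLaplacian_mulVec_leadingSeries τ r s ht hσ]
    rcases eq_or_ne v s with rfl | hv
    · simp
      ring
    · simp [hv, leadingSeries_add_linkDefect τ r σ s ht hv]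
      ring
  rw [congrFun (eq_greenMatrix_mulVec (isUnit_det_generalizedLaplacian σ ht₀) hmul) w, mulVec_add,
    mulVec_smul, mulVec_smul]
  simp [mulVec, dotProduct]

variable {σ} in
include ht in
theorem greenMatrix_mul_linkDefect (hσ : σ.CliqueFree 3) {c : ℤ⟦X⟧}
    (hc : (1 + t) * greenMatrix t σ s s = 1 - t * c) :
    greenMatrix t σ s s * (1 + t) * linkDefect τ r σ s s = c * leadingSeries τ r σ s s +
      (1 + t) * (greenMatrix t σ s s - ∑ v, greenMatrix t σ s v) * 𝓕 ∅ := by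
  have ht₀ : t ≠ 0 := by
    rintro rfl
    exact X_ne_zero (R := ℤ) (by simpa using ht.symm)
  refine mul_left_cancel₀ ht₀ ?_
  linear_combination -leadingSeries_eq τ r s ht hσ s - leadingSeries τ r σ s s * hc

variable {σ} in
include ht in
theorem greenMatrix_mul_sum_leadingSeries (hσ : σ.CliqueFree 3) :
    greenMatrix t σ s s * ∑ w, leadingSeries τ r σ s w =
      t * (1 + t) * 𝓕 ∅ * (greenMatrix t σ s s * ∑ w, ∑ v, greenMatrix t σ w v) +
        (leadingSeries τ r σ s s - t * (1 + t) * 𝓕 ∅ * ∑ v, greenMatrix t σ s v) *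
          ∑ v, greenMatrix t σ s v := by
  have hcol : ∑ w, greenMatrix t σ w s = ∑ w, greenMatrix t σ s w :=
    Finset.sum_congr rfl fun w _ => (isSymm_greenMatrix t σ).apply s w
  have hsum := Finset.sum_congr rfl fun w (_ : w ∈ Finset.univ) => leadingSeries_eq τ r s ht hσ w
  rw [Finset.sum_add_distrib, ← Finset.mul_sum, ← Finset.mul_sum, hcol] at hsum
  linear_combination greenMatrix t σ s s * hsum -
    (∑ v, greenMatrix t σ s v) * leadingSeries_eq τ r s ht hσ s

end Coalescence

section Comparison

open PowerSeries

theorem eq_of_forall_X_mul_dvd {ι R : Type*} [CommRing R] {f g : ι → R⟦X⟧}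
    (h : ∀ d, (∀ i, d ∣ f i - g i) → ∀ i, X * d ∣ f i - g i) : f = g := by
  have hpow (n : ℕ) : ∀ i, X ^ n ∣ f i - g i := by
    induction n with
    | zero => simp
    | succ n ih => rw [pow_succ']; exact h _ ih
  ext i n
  rw [← sub_eq_zero, ← map_sub]
  exact X_pow_dvd_iff.1 (hpow (n + 1) i) n n.lt_succ_self

variable {V W₁ W₂ : Type*} (τ : SimpleGraph V) (r : V) {σ₁ : SimpleGraph W₁} {s₁ : W₁}
  {σ₂ : SimpleGraph W₂} {s₂ : W₂} {t d : ℤ⟦X⟧}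

local notation "𝓕₁" => admissibleSeries (coalescence τ r σ₁ s₁)
local notation "𝓕₂" => admissibleSeries (coalescence τ r σ₂ s₂)

theorem dvd_leadingSeries_root_sub (hempty : d ∣ 𝓕₁ ∅ - 𝓕₂ ∅)
    (hroot : d ∣ 𝓕₁ {.inl r} - 𝓕₂ {.inl r}) :
    d ∣ leadingSeries τ r σ₁ s₁ s₁ - leadingSeries τ r σ₂ s₂ s₂ := by
  rw [leadingSeries, leadingSeries, coalescenceInr_root, coalescenceInr_root, sub_sub_sub_comm]
  exact hempty.sub hroot

variable [Finite V] [Fintype W₁] [DecidableEq W₁] [Fintype W₂] [DecidableEq W₂]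
  (ht : (1 + X) * t = X) (hσ₁ : σ₁.CliqueFree 3) (hσ₂ : σ₂.CliqueFree 3)
  (hroots : RootEquivalent t σ₁ s₁ σ₂ s₂)

include ht hσ₁ hσ₂ hroots

theorem dvd_linkDefect_root_sub (hempty : d ∣ 𝓕₁ ∅ - 𝓕₂ ∅)
    (hlead : d ∣ leadingSeries τ r σ₁ s₁ s₁ - leadingSeries τ r σ₂ s₂ s₂) :
    d ∣ linkDefect τ r σ₁ s₁ s₁ - linkDefect τ r σ₂ s₂ s₂ := by
  have ht₀ : constantCoeff t = 0 := constantCoeff_eq_zero_of_one_add_X_mul_eq ht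
  set g := greenMatrix t σ₁ s₁ s₁ with hg
  have hunit : IsUnit (g * (1 + t)) :=
    isUnit_iff_constantCoeff.2 (by simp [hg, constantCoeff_greenMatrix_self, ht₀])
  obtain ⟨c, hc⟩ : t ∣ 1 - (1 + t) * g := by
    refine (Dvd.intro_left (1 + X) ht).trans (X_dvd_iff.2 ?_)
    simp [ht₀, hg, constantCoeff_greenMatrix_self]
  have h₁ := greenMatrix_mul_linkDefect τ r s₁ ht hσ₁ (c := c) (by linear_combination -hc)
  have h₂ := greenMatrix_mul_linkDefect τ r s₂ ht hσ₂ (c := c)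
    (by rw [← hroots.apply_eq]; linear_combination -hc)
  rw [← hroots.apply_eq, ← hroots.rowSum_eq] at h₂
  refine hunit.dvd_mul_left.1 ?_
  rw [mul_sub, h₁, h₂]
  convert (hlead.mul_left c).add
    (hempty.mul_left ((1 + t) * (g - ∑ w, greenMatrix t σ₁ s₁ w))) using 1
  ring

theorem dvd_sum_leadingSeries_sub (hempty : d ∣ 𝓕₁ ∅ - 𝓕₂ ∅)
    (hlead : d ∣ leadingSeries τ r σ₁ s₁ s₁ - leadingSeries τ r σ₂ s₂ s₂) :
    d ∣ ∑ w, leadingSeries τ r σ₁ s₁ w - ∑ w, leadingSeries τ r σ₂ s₂ w := by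
  have ht₀ : constantCoeff t = 0 := constantCoeff_eq_zero_of_one_add_X_mul_eq ht
  have h₂ := greenMatrix_mul_sum_leadingSeries τ r s₂ ht hσ₂
  rw [← hroots.apply_eq, ← hroots.rowSum_eq, ← hroots.sum_eq] at h₂
  have hunit : IsUnit (greenMatrix t σ₁ s₁ s₁) :=
    isUnit_iff_constantCoeff.2 (by simp [constantCoeff_greenMatrix_self, ht₀])
  refine hunit.dvd_mul_left.1 ?_
  rw [mul_sub, greenMatrix_mul_sum_leadingSeries τ r s₁ ht hσ₁, h₂]
  set h := ∑ w, greenMatrix t σ₁ s₁ w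
  convert (hempty.mul_left (t * (1 + t) * (greenMatrix t σ₁ s₁ s₁ *
    ∑ v, ∑ w, greenMatrix t σ₁ v w - h ^ 2))).add (hlead.mul_left h) using 1
  ring

theorem X_mul_dvd_admissibleSeries_image_inl_sub
    (hd : ∀ C : Set V, d ∣ 𝓕₁ (.inl '' C) - 𝓕₂ (.inl '' C)) (C : Set V) :
    X * d ∣ 𝓕₁ (.inl '' C) - 𝓕₂ (.inl '' C) := by
  classical
  have := Fintype.ofFinite V
  have hempty : d ∣ 𝓕₁ ∅ - 𝓕₂ ∅ := by simpa only [Set.image_empty] using hd ∅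
  have hroot : d ∣ 𝓕₁ {.inl r} - 𝓕₂ {.inl r} := by simpa only [Set.image_singleton] using hd {r}
  have hlead := dvd_leadingSeries_root_sub τ r hempty hroot
  have hinl : d ∣ ∑ v, ((if v ∈ C then 0 else 𝓕₁ (.inl '' descentStep τ C v)) -
      if v ∈ C then 0 else 𝓕₂ (.inl '' descentStep τ C v)) := by
    refine Finset.dvd_sum fun v _ => ?_
    split_ifs
    · simp
    · exact hd _
  have hinr : d ∣ ∑ w : {w : W₁ // w ≠ s₁}, 𝓕₁ {.inr w} -
      ∑ w : {w : W₂ // w ≠ s₂}, 𝓕₂ {.inr w} := by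
    have hcard : Fintype.card W₁ = Fintype.card W₂ :=
      hroots.card_eq (constantCoeff_eq_zero_of_one_add_X_mul_eq ht)
    rw [sum_admissibleSeries_inr, sum_admissibleSeries_inr, hcard]
    have hsum := dvd_sum_leadingSeries_sub τ r ht hσ₁ hσ₂ hroots hempty hlead
    convert ((hempty.mul_left (Fintype.card W₂ : ℤ⟦X⟧)).sub hsum).sub hroot using 1
    ring
  have hlink : d ∣ (if r ∈ C then linkDefect τ r σ₁ s₁ s₁ else 0) -
      if r ∈ C then linkDefect τ r σ₂ s₂ s₂ else 0 := by
    split_ifs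
    · exact dvd_linkDefect_root_sub τ r ht hσ₁ hσ₂ hroots hempty hlead
    · simp
  rw [admissibleSeries_image_inl, admissibleSeries_image_inl, add_sub_add_left_eq_sub, ← mul_sub]
  refine mul_dvd_mul_left X ?_
  rw [add_sub_add_comm, add_sub_add_comm, ← Finset.sum_sub_distrib]
  exact hinl.add (hinr.add hlink)

theorem geodesicGrowthSeries_coalescence_eq :
    geodesicGrowthSeries (coalescence τ r σ₁ s₁) =
      geodesicGrowthSeries (coalescence τ r σ₂ s₂) := by
  have hstates : (fun C : Set V => 𝓕₁ (.inl '' C)) = fun C => 𝓕₂ (.inl '' C) :=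
    eq_of_forall_X_mul_dvd fun _ =>
      X_mul_dvd_admissibleSeries_image_inl_sub τ r ht hσ₁ hσ₂ hroots
  refine PowerSeries.map_injective (Nat.castRingHom ℤ) Nat.cast_injective ?_
  rw [map_geodesicGrowthSeries, map_geodesicGrowthSeries]
  simpa only [Set.image_empty] using congrFun hstates ∅

end Comparison

section McKay

open Matrix PowerSeries

theorem cliqueFree_three_mckayT₂ : mckayT₂.CliqueFree 3 := by
  let colour : Fin 16 → Bool := fun v => v ∈ ({1, 2, 6, 7, 8, 9, 12, 13} : Finset (Fin 16))
  have hcolour : ∀ {v w}, mckayT₂.Adj v w → colour v ≠ colour w := by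
    simp only [mckayT₂, SimpleGraph.fromEdgeSet_adj, Set.mem_insert_iff, Set.mem_singleton_iff]
    decide
  exact (SimpleGraph.Coloring.mk colour hcolour).colorable.cliqueFree (by simp)

/-- McKay's two trees are the same tree with two different roots: the root of the first one is the
vertex `9` of the second one. -/
def mckayIso : mckayT₁ ≃g mckayT₂ where
  toFun := ![9, 11, 5, 12, 13, 2, 14, 15, 4, 0, 8, 1, 10, 3, 6, 7]
  invFun := ![9, 11, 5, 13, 8, 2, 14, 15, 10, 0, 12, 1, 3, 4, 6, 7]
  left_inv := by unfold Function.LeftInverse; decide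
  right_inv := by unfold Function.RightInverse Function.LeftInverse; decide
  map_rel_iff' := by
    simp only [mckayT₁, mckayT₂, SimpleGraph.fromEdgeSet_adj, Set.mem_insert_iff,
      Set.mem_singleton_iff]
    decide

/-- A multiple of the difference of the columns of the Green matrix of `mckayT₂` at the vertices `9`
and `0`, found by solving the linear system over `ℚ(t)` and clearing denominators. -/
def mckayColumnDiff {R : Type*} [CommRing R] (t : R) : Fin 16 → R :=
  ![-1 + 4 * t - 4 * t ^ 2 - t ^ 3 + 5 * t ^ 4 - 5 * t ^ 5 - t ^ 6 + 2 * t ^ 7,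
    t ^ 2 - 3 * t ^ 3 + t ^ 4 + 2 * t ^ 5 - 2 * t ^ 6 + 2 * t ^ 7 + 2 * t ^ 8,
    t ^ 2 - 2 * t ^ 3 + t ^ 4 - 2 * t ^ 6 + t ^ 7,
    -t ^ 4 + t ^ 5 + t ^ 6,
    -t ^ 4 + t ^ 5 + t ^ 8,
    -t ^ 2 + 3 * t ^ 3 - 2 * t ^ 4 - t ^ 5 + 3 * t ^ 6 - 2 * t ^ 7 - t ^ 8,
    t ^ 6 - t ^ 7 - t ^ 8,
    t ^ 6 - t ^ 7 - t ^ 8,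
    t ^ 6,
    1 - 4 * t + 4 * t ^ 2 + t ^ 3 - 5 * t ^ 4 + 5 * t ^ 5 + t ^ 6 - 2 * t ^ 7,
    -t ^ 8,
    -t ^ 2 + 2 * t ^ 3 - t ^ 5 + t ^ 6 - t ^ 7 - t ^ 8,
    t ^ 4 - t ^ 5 - t ^ 6,
    t ^ 4 - t ^ 5 - t ^ 6,
    -t ^ 6 + t ^ 7 + t ^ 8,
    -t ^ 6 + t ^ 7 + t ^ 8]

/-- The factor by which `mckayColumnDiff` exceeds the difference of the columns. -/
def mckayDenominator {R : Type*} [CommRing R] (t : R) : R :=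
  1 - 5 * t + 8 * t ^ 2 - 3 * t ^ 3 - 8 * t ^ 4 + 15 * t ^ 5 - 6 * t ^ 6 - 5 * t ^ 7 + 6 * t ^ 8 -
    3 * t ^ 9 - 2 * t ^ 10

theorem generalizedLaplacian_mulVec_mckayColumnDiff {R : Type*} [CommRing R] (t : R) :
    generalizedLaplacian t mckayT₂ *ᵥ mckayColumnDiff t =
      mckayDenominator t • (Pi.single 9 1 - Pi.single 0 1) := by
  ext v
  rw [generalizedLaplacian_mulVec, Finset.sum_filter]
  fin_cases v <;>
    simp [Fin.sum_univ_succ, mckayT₂, mckayColumnDiff, mckayDenominator] <;> ring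

theorem sum_mckayColumnDiff {R : Type*} [CommRing R] (t : R) : ∑ v, mckayColumnDiff t v = 0 := by
  simp [Fin.sum_univ_succ, mckayColumnDiff]
  ring

theorem rootEquivalent_mckay {t : ℤ⟦X⟧} (ht : constantCoeff t = 0) :
    RootEquivalent t mckayT₁ 0 mckayT₂ 0 := by
  have hden : mckayDenominator t ≠ 0 := by
    intro h
    simpa [mckayDenominator, ht] using congrArg constantCoeff h
  have hroots : mckayColumnDiff t 9 + mckayColumnDiff t 0 = 0 := by
    simp only [mckayColumnDiff, cons_val]
    ring
  have h90 : RootEquivalent t mckayT₂ 9 mckayT₂ 0 :=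
    .of_mulVec_eq (isUnit_det_generalizedLaplacian mckayT₂ ht) hden
      (generalizedLaplacian_mulVec_mckayColumnDiff t) hroots (sum_mckayColumnDiff t)
  exact (RootEquivalent.of_iso mckayIso 0).trans h90

theorem exists_one_add_X_mul_eq_X (R : Type*) [CommRing R] :
    ∃ t : R⟦X⟧, (1 + X) * t = X := by
  have hunit : IsUnit (1 + X : R⟦X⟧) := isUnit_iff_constantCoeff.2 (by simp)
  obtain ⟨t, ht⟩ := hunit.dvd (a := X)
  exact ⟨t, ht.symm⟩

theorem lemma3p2_general {V : Type*} [Finite V] (τ : SimpleGraph V) (root : V) :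
    geodesicGrowthSeries (coalescence τ root mckayT₁ 0) =
      geodesicGrowthSeries (coalescence τ root mckayT₂ 0) := by
  obtain ⟨t, ht⟩ := exists_one_add_X_mul_eq_X ℤ
  exact geodesicGrowthSeries_coalescence_eq τ root ht
    (cliqueFree_three_mckayT₂.comap mckayIso.toEmbedding.isContained) cliqueFree_three_mckayT₂
    (rootEquivalent_mckay (constantCoeff_eq_zero_of_one_add_X_mul_eq ht))

end McKay

theorem lemma3p2 {V : Type*} [Finite V] (τ : SimpleGraph V) (hτ : τ.IsTree) (root : V) :
    geodesicGrowthSeries (coalescence τ root mckayT₁ 0) =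
      geodesicGrowthSeries (coalescence τ root mckayT₂ 0) :=
  lemma3p2_general τ root
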